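/- Theorem. Let $1\le p<N$ be fixed integers, let $X\in\mathbb{R}^{N\times p}$ be a fixed matrix of full rank $p$ with rows $x_1^{\mathsf T},\dots,x_N^{\mathsf T}$, let $\beta\in\mathbb{R}^p$, $\sigma>0$, and let $Y=(y_1,\dots,y_N)^{\mathsf T}$ with $y_i=x_i^{\mathsf T}\beta+\epsilon_i$, where $\epsilon_1,\dots,\epsilon_N$ are i.i.d. $\mathcal N(0,\sigma^2)$. Let $\pi=(\pi_1,\dots,\pi_N)$ be a fixed probability vector with $\pi_i>0$ for all $i$. For each $r$, let $s_1,\dots,s_r$ be i.i.d. indices with $\mathbb{P}(s_k=i)=\pi_i$, independent of $(\epsilon_1,\dots,\epsilon_N)$. Let $S_X$ be the $N\times r$ matrix whose $(i,k)$ entry is $1$ if $s_k=i$ and $0$ otherwise, let $D$ be the $r\times r$ diagonal matrix with $k$th diagonal entry $1/\sqrt{r\pi_{s_k}}$, and put $W=S_XD^2S_X^{\mathsf T}$. When $X^{\mathsf T}WX$ is invertible, define $$\hat\beta_W=(X^{\mathsf T}WX)^{-1}X^{\mathsf T}WY,\qquad \hat\sigma^2=\frac{1}{N-p}\,\|Y-X\hat\beta_W\|_2^2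 ,$$ and, for $0<\alpha<1$ and $1\le j\le p$, let $C_{r,j}$ be the closed interval $$(\hat\beta_W)_j\ \pm\ t_{N-p,1-\alpha/2}\,\hat\sigma\,\sqrt{\bigl((X^{\mathsf T}WX)^{-1}X^{\mathsf T}W^2X(X^{\mathsf T}WX)^{-1}\bigr)_{jj}}\,,$$ where $\hat\sigma=\sqrt{\hat\sigma^2}$ and $t_{N-p,1-\alpha/2}$ is the $1-\alpha/2$ quantile of Student's $t$ distribution with $N-p$ degrees of freedom. Then, as $r\to\infty$ with $N,p,X,\beta,\sigma,\pi,\alpha,j$ fixed, the interval $C_{r,j}$ is defined with probability tending to one and has asymptotic coverage probability $1-\alpha$: $$\mathbb{P}\bigl(X^{\mathsf T}WX\text{ is invertible}\bigr)\to 1,\qquad \mathbb{P}\bigl(X^{\mathsf T}WX\text{ is invertible and }\beta_j\in C_{r,j}\bigr)\to 1-\alpha .$$ -/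

import Mathlib

open MeasureTheory ProbabilityTheory Filter Topology
open scoped Matrix

namespace AlgLev

noncomputable section

/-! ### Student's t distribution and quantiles -/

/-- The chi-squared distribution with `ν` degrees of freedom: the law of the sum of squares of
`ν` independent standard normal variables. -/
def chiSquared (ν : ℕ) : Measure ℝ :=
  (Measure.pi fun _ : Fin ν => gaussianReal 0 1).map fun z => ∑ i, z i ^ 2

/-- Student's t distribution with `ν` degrees of freedom: the law of `Z / √(V / ν)` where `Z` is
standard normal, `V` is chi-squared with `ν` degrees of freedom, and `Z`, `V` are independent. -/
def studentT (ν : ℕ) : Measure ℝ :=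
  ((gaussianReal 0 1).prod (chiSquared ν)).map fun q => q.1 / √(q.2 / ν)

instance instIsProbabilityMeasureChiSquared (ν : ℕ) : IsProbabilityMeasure (chiSquared ν) :=
  Measure.isProbabilityMeasure_map
    (Finset.measurable_fun_sum _ fun i _ => (measurable_pi_apply i).pow_const 2).aemeasurable

instance instIsProbabilityMeasureStudentT (ν : ℕ) : IsProbabilityMeasure (studentT ν) :=
  Measure.isProbabilityMeasure_map
    (measurable_fst.div (measurable_snd.div_const _).sqrt).aemeasurable

/-- The `u`-quantile of a probability measure on the real line (for `0 < u < 1`). -/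
def quantile (μ : Measure ℝ) (u : ℝ) : ℝ := sInf {x : ℝ | u ≤ cdf μ x}

/-! ### Algorithmic leveraging

`s : Fin r → Fin N` lists the sampled observations (`s i` is the observation drawn at step `i`),
and `π` is the sampling distribution on the `N` observations. -/

variable {N p r : ℕ}

/-- The `N × r` matrix `S_X`, with entry `(j, i)` equal to `1` if the `i`-th sample is the `j`-th
observation and `0` otherwise. -/
def samplingMatrix (s : Fin r → Fin N) : Matrix (Fin N) (Fin r) ℝ :=
  Matrix.of fun j i => if s i = j then 1 else 0

/-- The `r × r` diagonal matrix `D` with `i`-th diagonal entry `1 / √(r π_j)` if the `i`-th sample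
is the `j`-th observation. -/
def scalingMatrix (π : Fin N → ℝ) (s : Fin r → Fin N) : Matrix (Fin r) (Fin r) ℝ :=
  Matrix.diagonal fun i => 1 / √((r : ℝ) * π (s i))

/-- `W = S_X D² S_Xᵀ`. -/
def weightMatrix (π : Fin N → ℝ) (s : Fin r → Fin N) : Matrix (Fin N) (Fin N) ℝ :=
  samplingMatrix s * scalingMatrix π s ^ 2 * (samplingMatrix s)ᵀ

/-- The weighted least squares estimate `(XᵀWX)⁻¹ XᵀW y`. -/
def betaHat (X : Matrix (Fin N) (Fin p) ℝ) (W : Matrix (Fin N) (Fin N) ℝ) (y : Fin N → ℝ) :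
    Fin p → ℝ :=
  ((Xᵀ * W * X)⁻¹ * Xᵀ * W) *ᵥ y

/-- The variance estimate `‖y - X β̂_W‖₂² / (N - p)`. -/
def sigmaHatSq (X : Matrix (Fin N) (Fin p) ℝ) (W : Matrix (Fin N) (Fin N) ℝ) (y : Fin N → ℝ) : ℝ :=
  1 / ((N : ℝ) - p) * ∑ i, (y i - (X *ᵥ betaHat X W y) i) ^ 2

/-- The matrix `(XᵀWX)⁻¹ XᵀW²X (XᵀWX)⁻¹`. -/
def sandwich (X : Matrix (Fin N) (Fin p) ℝ) (W : Matrix (Fin N) (Fin N) ℝ) :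
    Matrix (Fin p) (Fin p) ℝ :=
  (Xᵀ * W * X)⁻¹ * (Xᵀ * W ^ 2 * X) * (Xᵀ * W * X)⁻¹

/-- The half-width of the confidence interval for the `j`-th coefficient. -/
def halfWidth (X : Matrix (Fin N) (Fin p) ℝ) (W : Matrix (Fin N) (Fin N) ℝ) (y : Fin N → ℝ)
    (α : ℝ) (j : Fin p) : ℝ :=
  quantile (studentT (N - p)) (1 - α / 2) * √(sigmaHatSq X W y) * √(sandwich X W j j)

/-- The confidence interval for the `j`-th coefficient. -/
def confInterval (X : Matrix (Fin N) (Fin p) ℝ) (W : Matrix (Fin N) (Fin N) ℝ) (y : Fin N → ℝ)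
    (α : ℝ) (j : Fin p) : Set ℝ :=
  Set.Icc (betaHat X W y j - halfWidth X W y α j) (betaHat X W y j + halfWidth X W y α j)

end

end AlgLev

namespace AlgLev

/-! ### Quantiles and Student's t distribution -/

/-! The draws and the errors are independent, so the coverage probability is the expectation, over
the draws, of `f W`, where `f V` is the coverage of the interval built with a fixed weight matrix
`V` (`measureReal_mem_eq_integral`). It then suffices to prove three facts.

`W` tends to the identity in probability: it is diagonal, and its entries are means of i.i.d.
bounded variables of expectation 1, so Chebyshev's inequality applies
(`tendsto_measureReal_weightMatrix_notMem`).

`f 1 = 1 - α` exactly: with identity weights the interval is the classical least squares t interval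
(`measureReal_abs_betaHat_one_le`).

`f` is continuous at 1: since `Xᵀ * X` is invertible, for each fixed error vector the centre and
half-width are continuous in `V` at 1. The t law has no atoms, so almost surely `β j` is not an
endpoint at `V = 1`; the coverage indicator is then locally constant, and dominated convergence
applies (`tendsto_measureReal_covers`).

As `f` is bounded, the expectation of `f W` tends to `f 1`. -/

lemma continuous_cdf (μ : Measure ℝ) [IsProbabilityMeasure μ] [NullSingletonClass μ] :
    Continuous (cdf μ) := by
  refine continuous_iff_continuousAt.2 fun x => ?_
  rw [(monotone_cdf μ).continuousAt_iff_leftLim_eq_rightLim, StieltjesFunction.rightLim_eq]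
  refine le_antisymm ((monotone_cdf μ).leftLim_le le_rfl) ?_
  have h := (cdf μ).measure_singleton x
  rw [measure_cdf, measure_singleton, eq_comm, ENNReal.ofReal_eq_zero] at h
  linarith

lemma cdf_quantile (μ : Measure ℝ) [IsProbabilityMeasure μ] [NullSingletonClass μ] {u : ℝ}
    (h0 : 0 < u) (h1 : u < 1) : cdf μ (quantile μ u) = u := by
  have hc := continuous_cdf μ
  obtain ⟨a, ha⟩ := ((tendsto_cdf_atBot μ).eventually_lt_const h0).exists
  obtain ⟨b, hb⟩ := ((tendsto_cdf_atTop μ).eventually_const_lt h1).exists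
  obtain ⟨x, hx⟩ := mem_range_of_exists_le_of_exists_ge hc ⟨a, ha.le⟩ ⟨b, hb.le⟩
  -- Without a lower bound `sInf` would take the default value 0.
  have hbdd : BddBelow {x : ℝ | u ≤ cdf μ x} := by
    refine ⟨a, fun y hy => ?_⟩
    by_contra! hlt
    exact absurd (hy.trans (monotone_cdf μ hlt.le)) (not_le.2 ha)
  refine le_antisymm ?_ ?_
  · exact (monotone_cdf μ (csInf_le hbdd hx.ge)).trans hx.le
  · exact (isClosed_le continuous_const hc).csInf_mem ⟨x, hx.ge⟩ hbdd

/-- An atomless symmetric law gives mass `1 - α` to the interval between its `α / 2` and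
`1 - α / 2` quantiles. -/
lemma measureReal_Icc_quantile (μ : Measure ℝ) [IsProbabilityMeasure μ] [NullSingletonClass μ]
    (hsymm : μ.map (fun x => -x) = μ) {α : ℝ} (hα0 : 0 < α) (hα1 : α < 1) :
    μ.real (Set.Icc (-quantile μ (1 - α / 2)) (quantile μ (1 - α / 2))) = 1 - α := by
  set q := quantile μ (1 - α / 2) with hq
  have h1 : μ.real (Set.Iic q) = 1 - α / 2 := by
    rw [← cdf_eq_real, hq, cdf_quantile μ (by linarith) (by linarith)]
  have h2 : μ.real (Set.Iio (-q)) = α / 2 := by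
    have h3 : μ.real (Set.Iio (-q)) = μ.real (Set.Ioi q) := by
      conv_lhs => rw [← hsymm]
      rw [map_measureReal_apply measurable_neg measurableSet_Iio]
      congr 1
      ext x
      simp
    rw [h3, ← Set.compl_Iic, probReal_compl_eq_one_sub measurableSet_Iic, h1]
    ring
  have h4 : -q ≤ q := by
    by_contra! hlt
    have : μ.real (Set.Iic q) ≤ μ.real (Set.Iio (-q)) :=
      measureReal_mono fun x (hx : x ≤ q) => lt_of_le_of_lt hx hlt
    linarith
  have h5 : Set.Icc (-q) q = Set.Iic q \ Set.Iio (-q) := by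
    ext x
    simp [and_comm]
  have h6 : Set.Iio (-q) ⊆ Set.Iic q := fun x hx => (le_of_lt hx).trans h4
  rw [h5, measureReal_sdiff h6 measurableSet_Iio, h1, h2]
  ring

lemma measurable_studentRatio (ν : ℕ) : Measurable fun q : ℝ × ℝ => q.1 / √(q.2 / ν) :=
  measurable_fst.div (measurable_snd.div_const _).sqrt

lemma ae_chiSquared_pos {ν : ℕ} (hν : 0 < ν) : ∀ᵐ v ∂chiSquared ν, 0 < v := by
  have hm : Measurable fun z : Fin ν → ℝ => ∑ i, z i ^ 2 := by fun_prop
  rw [chiSquared, ae_map_iff hm.aemeasurable measurableSet_Ioi]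
  have : NullSingletonClass (gaussianReal 0 1) := nullSingletonClass_gaussianReal one_ne_zero
  have h : ∀ᵐ z ∂(Measure.pi fun _ : Fin ν => gaussianReal 0 1), z ⟨0, hν⟩ ≠ 0 :=
    (measurePreserving_eval (fun _ : Fin ν => gaussianReal 0 1)
      ⟨0, hν⟩).quasiMeasurePreserving.ae (Measure.ae_ne _ 0)
  filter_upwards [h] with z hz
  exact Finset.sum_pos' (fun i _ => sq_nonneg _) ⟨⟨0, hν⟩, Finset.mem_univ _, by positivity⟩

/-- For a fixed denominator `v > 0`, a singleton pulls back to one value of the normal numerator, a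
null set. At `v = 0` the ratio is identically 0 by convention, hence the need for almost sure
positivity of `v`. -/
lemma nullSingletonClass_studentT {ν : ℕ} (hν : 0 < ν) : NullSingletonClass (studentT ν) := by
  have : NullSingletonClass (gaussianReal 0 1) := nullSingletonClass_gaussianReal one_ne_zero
  refine ⟨fun x => ?_⟩
  have hms : MeasurableSet ((fun q : ℝ × ℝ => q.1 / √(q.2 / ν)) ⁻¹' {x}) :=
    measurable_studentRatio ν (measurableSet_singleton x)
  rw [studentT, Measure.map_apply (measurable_studentRatio ν) (measurableSet_singleton x),
    Measure.prod_apply_symm hms, lintegral_eq_zero_iff (measurable_measure_prodMk_right hms)]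
  filter_upwards [ae_chiSquared_pos hν] with v hv
  have hpos : 0 < √(v / ν) := by positivity
  refine measure_mono_null (t := {x * √(v / ν)}) (fun z hz => ?_) (measure_singleton _)
  exact (div_eq_iff hpos.ne').1 hz

lemma map_neg_studentT (ν : ℕ) : (studentT ν).map (fun x => -x) = studentT ν := by
  have hprod : MeasurePreserving (Prod.map (fun x : ℝ => -x) id)
      ((gaussianReal 0 1).prod (chiSquared ν)) ((gaussianReal 0 1).prod (chiSquared ν)) := by
    refine MeasurePreserving.prod ⟨measurable_neg, ?_⟩ (MeasurePreserving.id _)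
    rw [gaussianReal_map_neg, neg_zero]
  conv_rhs => rw [studentT, ← hprod.map_eq,
    Measure.map_map (measurable_studentRatio ν) hprod.measurable]
  rw [studentT, Measure.map_map measurable_neg (measurable_studentRatio ν)]
  congr 1
  ext q
  simp [neg_div]

lemma studentT_real_Icc_quantile {ν : ℕ} (hν : 0 < ν) {α : ℝ} (hα0 : 0 < α) (hα1 : α < 1) :
    (studentT ν).real (Set.Icc (-quantile (studentT ν) (1 - α / 2))
      (quantile (studentT ν) (1 - α / 2))) = 1 - α := by
  have := nullSingletonClass_studentT hν
  exact measureReal_Icc_quantile _ (map_neg_studentT ν) hα0 hα1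

/-! ### Orthogonal projections of a standard Gaussian vector -/

/-- The characteristic function of the coordinates at `t` is that of the Gaussian at `∑ i, t i • v
i`, which has the norm of `t` by orthonormality; a standard Gaussian characteristic function depends
on the norm only. -/
lemma map_inner_stdGaussian {ι E : Type*} [Fintype ι] [NormedAddCommGroup E]
    [InnerProductSpace ℝ E] [FiniteDimensional ℝ E] [MeasurableSpace E] [BorelSpace E]
    {v : ι → E} (hv : Orthonormal ℝ v) :
    (stdGaussian E).map (fun x => WithLp.toLp 2 fun i => inner ℝ (v i) x) =
      stdGaussian (EuclideanSpace ℝ ι) := by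
  have hm : Measurable fun x : E => WithLp.toLp 2 fun i => inner ℝ (v i) x := by fun_prop
  have : IsProbabilityMeasure
      ((stdGaussian E).map (fun x => WithLp.toLp 2 fun i => inner ℝ (v i) x)) :=
    Measure.isProbabilityMeasure_map hm.aemeasurable
  refine Measure.ext_of_charFun (E := EuclideanSpace ℝ ι) ?_
  ext t
  have hinner : ∀ x : E, inner ℝ (WithLp.toLp 2 fun i => inner ℝ (v i) x) t =
      inner ℝ x (∑ i, t i • v i) := by
    intro x
    simp [PiLp.inner_apply, inner_sum, inner_smul_right, real_inner_comm]
  have hnorm : ‖∑ i, t i • v i‖ ^ 2 = ‖t‖ ^ 2 := by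
    rw [EuclideanSpace.real_norm_sq_eq, ← real_inner_self_eq_norm_sq, hv.inner_sum]
    simp [sq]
  rw [charFun_apply, integral_map hm.aemeasurable (by fun_prop)]
  simp_rw [hinner]
  rw [← charFun_apply, charFun_stdGaussian, charFun_stdGaussian]
  norm_cast
  rw [hnorm]

/-- The coordinates of a standard Gaussian vector along an orthonormal family are independent
standard Gaussian variables. -/
lemma measurePreserving_dotProduct_of_orthonormal {ι κ : Type*} [Fintype ι] [Fintype κ]
    {v : ι → EuclideanSpace ℝ κ} (hv : Orthonormal ℝ v) :
    MeasurePreserving (fun (z : κ → ℝ) i => (v i).ofLp ⬝ᵥ z)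
      (Measure.pi fun _ => gaussianReal 0 1) (Measure.pi fun _ => gaussianReal 0 1) := by
  refine ⟨by unfold dotProduct; fun_prop, ?_⟩
  have h := map_inner_stdGaussian hv
  rw [← map_pi_eq_stdGaussian, ← map_pi_eq_stdGaussian,
    Measure.map_map (by fun_prop) (by fun_prop)] at h
  have h' := congrArg (Measure.map (WithLp.ofLp (p := 2) (V := ι → ℝ))) h
  rw [Measure.map_map (by fun_prop) (by fun_prop),
    Measure.map_map (by fun_prop) (by fun_prop)] at h'
  convert h' using 2
  · ext z i
    simp [PiLp.inner_apply, dotProduct, mul_comm]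
  · exact Measure.map_id.symm

lemma measurePreserving_studentT (ν : ℕ) :
    MeasurePreserving (fun z : Fin (ν + 1) → ℝ => z 0 / √((∑ i : Fin ν, z i.succ ^ 2) / ν))
      (Measure.pi fun _ => gaussianReal 0 1) (studentT ν) := by
  have hm : Measurable fun z : Fin ν → ℝ => ∑ i, z i ^ 2 := by fun_prop
  have h1 := measurePreserving_piFinSuccAbove (fun _ : Fin (ν + 1) => gaussianReal 0 1) 0
  have h2 : MeasurePreserving (Prod.map id fun z : Fin ν → ℝ => ∑ i, z i ^ 2)
      ((gaussianReal 0 1).prod (Measure.pi fun _ => gaussianReal 0 1))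
      ((gaussianReal 0 1).prod (chiSquared ν)) :=
    (MeasurePreserving.id _).prod ⟨hm, rfl⟩
  have h3 : MeasurePreserving (fun q : ℝ × ℝ => q.1 / √(q.2 / ν))
      ((gaussianReal 0 1).prod (chiSquared ν)) (studentT ν) :=
    ⟨measurable_studentRatio ν, rfl⟩
  have := (h3.comp h2).comp h1
  convert this using 1
  ext z
  simp [Fin.tail]

section

/-! ### Weighted least squares -/

variable {N p : ℕ} (X : Matrix (Fin N) (Fin p) ℝ)

lemma isUnit_transpose_mul_self {X : Matrix (Fin N) (Fin p) ℝ} (hX : X.rank = p) :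
    IsUnit (Xᵀ * X) := by
  rw [← Matrix.mulVec_injective_iff_isUnit]
  have h := (Xᵀ * X).mulVecLin.finrank_range_add_finrank_ker
  have h' : Module.finrank ℝ (Xᵀ * X).mulVecLin.range = p :=
    (Matrix.rank_transpose_mul_self X).trans hX
  rw [h', Module.finrank_fin_fun, Nat.add_eq_left, Submodule.finrank_eq_zero] at h
  exact LinearMap.ker_eq_bot.1 h

lemma betaHat_affine {W : Matrix (Fin N) (Fin N) ℝ} (hW : IsUnit (Xᵀ * W * X))
    (β : Fin p → ℝ) (σ : ℝ) (z : Fin N → ℝ) :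
    betaHat X W (X *ᵥ β + σ • z) = β + σ • betaHat X W z := by
  have h : (Xᵀ * W * X)⁻¹ * Xᵀ * W * X = 1 := by
    rw [Matrix.mul_assoc, Matrix.mul_assoc, ← Matrix.mul_assoc Xᵀ,
      Matrix.nonsing_inv_mul _ ((Matrix.isUnit_iff_isUnit_det _).1 hW)]
  rw [betaHat, Matrix.mulVec_add, Matrix.mulVec_mulVec, h, Matrix.one_mulVec, Matrix.mulVec_smul,
    betaHat]

lemma sigmaHatSq_affine {W : Matrix (Fin N) (Fin N) ℝ} (hW : IsUnit (Xᵀ * W * X))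
    (β : Fin p → ℝ) (σ : ℝ) (z : Fin N → ℝ) :
    sigmaHatSq X W (X *ᵥ β + σ • z) = σ ^ 2 * sigmaHatSq X W z := by
  simp only [sigmaHatSq, betaHat_affine X hW, Matrix.mulVec_add, Matrix.mulVec_smul, Pi.add_apply,
    Pi.smul_apply, smul_eq_mul, Finset.mul_sum]
  exact Finset.sum_congr rfl fun i _ => by ring

/-- Coverage is pivotal: the estimate is translated by `β` and scaled by `σ`, the half-width is only
scaled, so both parameters cancel. -/
lemma mem_confInterval_affine_iff {W : Matrix (Fin N) (Fin N) ℝ} (hW : IsUnit (Xᵀ * W * X))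
    (β : Fin p → ℝ) {σ : ℝ} (hσ : 0 < σ) (z : Fin N → ℝ) (α : ℝ) (j : Fin p) :
    β j ∈ confInterval X W (X *ᵥ β + σ • z) α j ↔ |betaHat X W z j| ≤ halfWidth X W z α j := by
  have hw : halfWidth X W (X *ᵥ β + σ • z) α j = σ * halfWidth X W z α j := by
    rw [halfWidth, halfWidth, sigmaHatSq_affine X hW, Real.sqrt_mul (sq_nonneg σ),
      Real.sqrt_sq hσ.le]
    ring
  rw [confInterval, hw, betaHat_affine X hW, ← mul_le_mul_iff_right₀ hσ, ← abs_of_pos hσ,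
    ← abs_mul, abs_of_pos hσ, abs_le, Set.mem_Icc, Pi.add_apply, Pi.smul_apply, smul_eq_mul]
  constructor <;> rintro ⟨h1, h2⟩ <;> constructor <;> linarith

/-- Ordinary least squares in orthonormal coordinates: along a suitable orthonormal family, the
`j`-th coefficient depends on one coordinate only and the residual sum of squares is the sum of
squares of the other ones. -/
lemma exists_orthonormal_leastSquares {X : Matrix (Fin N) (Fin p) ℝ} (hX : X.rank = p)
    (hpN : p < N) (j : Fin p) :
    ∃ v : Fin (N - p + 1) → EuclideanSpace ℝ (Fin N), Orthonormal ℝ v ∧ ∃ c : ℝ, 0 < c ∧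
      sandwich X 1 j j = c ^ 2 ∧
      (∀ z, betaHat X 1 z j = c * ((v 0).ofLp ⬝ᵥ z)) ∧
      ∀ z, sigmaHatSq X 1 z =
        (∑ i : Fin (N - p), ((v i.succ).ofLp ⬝ᵥ z) ^ 2) / (N - p : ℕ) := by
  have hdet := (Matrix.isUnit_iff_isUnit_det _).1 (isUnit_transpose_mul_self hX)
  set B := (Xᵀ * X)⁻¹ * Xᵀ with hB
  have hbeta : ∀ z, betaHat X 1 z = B *ᵥ z := by
    intro z
    simp [betaHat, hB]
  have hBX : B * X = 1 := by
    rw [hB, Matrix.mul_assoc, Matrix.nonsing_inv_mul _ hdet]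
  have hXXB : Xᵀ * (X * B) = Xᵀ := by
    rw [hB, ← Matrix.mul_assoc, ← Matrix.mul_assoc, Matrix.mul_nonsing_inv _ hdet, Matrix.one_mul]
  have hsand : sandwich X 1 = B * Bᵀ := by
    simp [sandwich, hB, Matrix.transpose_nonsing_inv, Matrix.mul_assoc]
  let T : EuclideanSpace ℝ (Fin N) →ₗ[ℝ] (Fin p → ℝ) :=
    Xᵀ.mulVecLin ∘ₗ (WithLp.linearEquiv 2 ℝ (Fin N → ℝ)).toLinearMap
  have hT : ∀ w, T w = Xᵀ *ᵥ w.ofLp := fun w => rfl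
  -- `K` is the orthogonal complement of the column space of `X`, where the residuals live.
  let K := LinearMap.ker T
  have hKdim : Module.finrank ℝ K = N - p := by
    have h := T.finrank_range_add_finrank_ker
    have h' : Module.finrank ℝ T.range = p := by
      have hr : T.range = Xᵀ.mulVecLin.range :=
        LinearMap.range_comp_of_range_eq_top _ (LinearEquiv.range _)
      rw [hr]
      exact (Matrix.rank_transpose X).trans hX
    rw [h', finrank_euclideanSpace_fin] at h
    exact Nat.eq_sub_of_add_eq' h
  let b : OrthonormalBasis (Fin (N - p)) ℝ K := (stdOrthonormalBasis ℝ K).reindex (finCongr hKdim)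
  have hbK : ∀ i, Xᵀ *ᵥ (b i : EuclideanSpace ℝ (Fin N)).ofLp = 0 := fun i => (b i).2
  have hBK : ∀ w : Fin N → ℝ, Xᵀ *ᵥ w = 0 → B *ᵥ w = 0 := by
    intro w hw
    rw [hB, ← Matrix.mulVec_mulVec, hw, Matrix.mulVec_zero]
  let a : EuclideanSpace ℝ (Fin N) := WithLp.toLp 2 (B j)
  have ha0 : a ≠ 0 := by
    intro h
    have h1 : B j = 0 := congrArg WithLp.ofLp h
    have h2 : (B * X) j j = 0 := by
      rw [Matrix.mul_apply]
      simp [h1]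
    simp [hBX] at h2
  have hapos : 0 < ‖a‖ := norm_pos_iff.2 ha0
  -- The first vector is the normalized `j`-th row of `B`. It is orthogonal to `K` because `B` ends
  -- in the factor `Xᵀ`, which kills `K`.
  refine ⟨Matrix.vecCons (‖a‖⁻¹ • a) fun i => (b i : EuclideanSpace ℝ (Fin N)), ?_, ‖a‖, hapos,
    ?_, ?_, ?_⟩
  · rw [orthonormal_vecCons_iff]
    refine ⟨?_, fun i => ?_, ?_⟩
    · rw [norm_smul, norm_inv, norm_norm, inv_mul_cancel₀ hapos.ne']
    · have h : (B *ᵥ (b i : EuclideanSpace ℝ (Fin N)).ofLp) j = 0 := by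
        rw [hBK _ (hbK i), Pi.zero_apply]
      have h' : inner ℝ a (b i : EuclideanSpace ℝ (Fin N)) = 0 := by
        rw [← h]
        simp [a, PiLp.inner_apply, Matrix.mulVec, dotProduct, mul_comm]
      rw [real_inner_smul_left, h', mul_zero]
    · exact b.orthonormal.comp_linearIsometry K.subtypeₗᵢ
  · rw [hsand, EuclideanSpace.real_norm_sq_eq, Matrix.mul_apply]
    exact Finset.sum_congr rfl fun i _ => by simp [a, sq]
  · intro z
    rw [hbeta]
    simp only [Matrix.cons_val_zero, WithLp.ofLp_smul, smul_dotProduct, smul_eq_mul]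
    rw [mul_inv_cancel_left₀ hapos.ne']
    rfl
  · intro z
    let e : EuclideanSpace ℝ (Fin N) := WithLp.toLp 2 (z - X *ᵥ (B *ᵥ z))
    have he : e ∈ K := by
      rw [LinearMap.mem_ker, hT]
      simp only [e, Matrix.mulVec_sub, Matrix.mulVec_mulVec]
      rw [hXXB, sub_self]
    -- The fitted part of `z` lies in the column space, hence is orthogonal to `b i`: the residual
    -- and `z` have the same coordinates in `K`. Parseval then gives the residual sum of squares.
    have hcoord : ∀ i, inner ℝ (b i) (⟨e, he⟩ : K) =
        (b i : EuclideanSpace ℝ (Fin N)).ofLp ⬝ᵥ z := by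
      intro i
      have h1 : (b i : EuclideanSpace ℝ (Fin N)).ofLp ⬝ᵥ (X *ᵥ (B *ᵥ z)) = 0 := by
        rw [Matrix.dotProduct_mulVec, ← Matrix.mulVec_transpose, hbK, zero_dotProduct]
      rw [← sub_zero ((b i : EuclideanSpace ℝ (Fin N)).ofLp ⬝ᵥ z), ← h1, ← dotProduct_sub]
      simp [e, PiLp.inner_apply, dotProduct, mul_comm]
    have hsum := b.sum_sq_inner_right (⟨e, he⟩ : K)
    simp_rw [hcoord] at hsum
    have hnorm : ‖(⟨e, he⟩ : K)‖ ^ 2 = ∑ i, (z i - (X *ᵥ betaHat X 1 z) i) ^ 2 := by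
      rw [Submodule.coe_norm, EuclideanSpace.real_norm_sq_eq, hbeta]
      rfl
    simp only [Matrix.cons_val_succ]
    rw [hsum, hnorm, sigmaHatSq, Nat.cast_sub hpN.le, one_div, inv_mul_eq_div]

end

section

/-! ### Coverage under a fixed weight matrix -/

variable {N p : ℕ} {X : Matrix (Fin N) (Fin p) ℝ}

lemma ae_sum_sq_succ_pos {ν : ℕ} (hν : 0 < ν) :
    ∀ᵐ w ∂(Measure.pi fun _ : Fin (ν + 1) => gaussianReal 0 1), 0 < ∑ i : Fin ν, w i.succ ^ 2 := by
  have : NullSingletonClass (gaussianReal 0 1) := nullSingletonClass_gaussianReal one_ne_zero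
  have h : ∀ᵐ w ∂(Measure.pi fun _ : Fin (ν + 1) => gaussianReal 0 1),
      w (Fin.succ ⟨0, hν⟩) ≠ 0 :=
    (measurePreserving_eval (fun _ : Fin (ν + 1) => gaussianReal 0 1)
      (Fin.succ ⟨0, hν⟩)).quasiMeasurePreserving.ae (Measure.ae_ne _ 0)
  filter_upwards [h] with z hz
  exact Finset.sum_pos' (fun i _ => sq_nonneg _) ⟨⟨0, hν⟩, Finset.mem_univ _, by positivity⟩

/-- Under ordinary least squares the studentized `j`-th coefficient follows Student's t
distribution. -/
lemma exists_measurePreserving_studentT (hX : X.rank = p) (hpN : p < N) (j : Fin p) :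
    ∃ T : (Fin N → ℝ) → ℝ,
      MeasurePreserving T (Measure.pi fun _ => gaussianReal 0 1) (studentT (N - p)) ∧
      ∀ᵐ z ∂(Measure.pi fun _ : Fin N => gaussianReal 0 1), ∃ c > 0,
        |betaHat X 1 z j| = c * |T z| ∧
        ∀ α, halfWidth X 1 z α j = c * quantile (studentT (N - p)) (1 - α / 2) := by
  obtain ⟨v, hv, c, hc, hsand, hbeta, hsigma⟩ := exists_orthonormal_leastSquares hX hpN j
  have hν : 0 < N - p := Nat.sub_pos_of_lt hpN
  have hmp := measurePreserving_dotProduct_of_orthonormal hv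
  refine ⟨_, (measurePreserving_studentT (N - p)).comp hmp, ?_⟩
  filter_upwards [hmp.quasiMeasurePreserving.ae (ae_sum_sq_succ_pos hν)] with z hz
  set R := √((∑ i : Fin (N - p), ((v i.succ).ofLp ⬝ᵥ z) ^ 2) / (N - p : ℕ)) with hR
  have hRpos : 0 < R := Real.sqrt_pos.2 (div_pos hz (Nat.cast_pos.2 hν))
  -- `c * R` is the estimated standard error of the `j`-th coefficient.
  refine ⟨c * R, mul_pos hc hRpos, ?_, fun α => ?_⟩
  · rw [hbeta, abs_mul, abs_of_pos hc, Function.comp_apply, ← hR, abs_div, abs_of_pos hRpos,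
      mul_assoc, mul_div_cancel₀ _ hRpos.ne']
  · rw [halfWidth, hsigma, hsand, Real.sqrt_sq hc.le, ← hR]
    ring

lemma measureReal_abs_betaHat_one_le (hX : X.rank = p) (hpN : p < N) (j : Fin p) {α : ℝ}
    (hα0 : 0 < α) (hα1 : α < 1) :
    (Measure.pi fun _ : Fin N => gaussianReal 0 1).real
      {z | |betaHat X 1 z j| ≤ halfWidth X 1 z α j} = 1 - α := by
  obtain ⟨T, hT, hz⟩ := exists_measurePreserving_studentT hX hpN j
  rw [← studentT_real_Icc_quantile (Nat.sub_pos_of_lt hpN) hα0 hα1,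
    ← hT.measureReal_preimage measurableSet_Icc.nullMeasurableSet]
  refine measureReal_congr ?_
  filter_upwards [hz] with z ⟨c, hc, h1, h2⟩
  refine propext ?_
  change |betaHat X 1 z j| ≤ halfWidth X 1 z α j ↔ T z ∈ Set.Icc _ _
  rw [h1, h2, mul_le_mul_iff_right₀ hc, abs_le, Set.mem_Icc]

/-- A tie puts the t statistic at plus or minus a quantile, which has probability zero. This
excludes the only points where the coverage indicator could be discontinuous at `W = 1`. -/
lemma ae_abs_betaHat_one_ne (hX : X.rank = p) (hpN : p < N) (j : Fin p) (α : ℝ) :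
    ∀ᵐ z ∂(Measure.pi fun _ : Fin N => gaussianReal 0 1),
      |betaHat X 1 z j| ≠ halfWidth X 1 z α j := by
  obtain ⟨T, hT, hz⟩ := exists_measurePreserving_studentT hX hpN j
  have := nullSingletonClass_studentT (Nat.sub_pos_of_lt hpN)
  set q := quantile (studentT (N - p)) (1 - α / 2)
  filter_upwards [hz, hT.quasiMeasurePreserving.ae (Measure.ae_ne _ q),
    hT.quasiMeasurePreserving.ae (Measure.ae_ne _ (-q))] with z ⟨c, hc, h1, h2⟩ h3 h4 h
  rw [h1, h2] at h
  rcases eq_or_eq_neg_of_abs_eq (mul_left_cancel₀ hc.ne' h) with h | h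
  exacts [h3 h, h4 h]

lemma eventually_isUnit (hX : X.rank = p) :
    ∀ᶠ W : Matrix (Fin N) (Fin N) ℝ in 𝓝 1, IsUnit (Xᵀ * W * X) := by
  have h1 : (Xᵀ * (1 : Matrix (Fin N) (Fin N) ℝ) * X).det ≠ 0 := by
    rw [Matrix.mul_one]
    exact ((Matrix.isUnit_iff_isUnit_det _).1 (isUnit_transpose_mul_self hX)).ne_zero
  have hc : Continuous fun W : Matrix (Fin N) (Fin N) ℝ => (Xᵀ * W * X).det := by fun_prop
  filter_upwards [hc.continuousAt.eventually_ne h1] with W hW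
  exact (Matrix.isUnit_iff_isUnit_det _).2 (isUnit_iff_ne_zero.2 hW)

lemma continuousAt_inv_gram (hX : X.rank = p) :
    ContinuousAt (fun W : Matrix (Fin N) (Fin N) ℝ => (Xᵀ * W * X)⁻¹) 1 := by
  have hdet : (Xᵀ * X).det ≠ 0 :=
    ((Matrix.isUnit_iff_isUnit_det _).1 (isUnit_transpose_mul_self hX)).ne_zero
  have h : ContinuousAt (Inv.inv : Matrix (Fin p) (Fin p) ℝ → _) (Xᵀ * (1 : Matrix (Fin N) (Fin N) ℝ) * X) := by
    refine continuousAt_matrix_inv _ ?_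
    rw [Matrix.mul_one, Ring.inverse_eq_inv']
    exact continuousAt_inv₀ hdet
  have hc : Continuous fun W : Matrix (Fin N) (Fin N) ℝ => Xᵀ * W * X := by fun_prop
  exact ContinuousAt.comp (f := fun W : Matrix (Fin N) (Fin N) ℝ => Xᵀ * W * X) h
    hc.continuousAt

lemma continuousAt_betaHat (hX : X.rank = p) (z : Fin N → ℝ) :
    ContinuousAt (fun W => betaHat X W z) 1 := by
  have h : Continuous fun q : Matrix (Fin p) (Fin p) ℝ × Matrix (Fin N) (Fin N) ℝ =>
      (q.1 * Xᵀ * q.2) *ᵥ z := by fun_prop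
  exact ContinuousAt.comp (f := fun W : Matrix (Fin N) (Fin N) ℝ => ((Xᵀ * W * X)⁻¹, W))
    (g := fun q : Matrix (Fin p) (Fin p) ℝ × Matrix (Fin N) (Fin N) ℝ => (q.1 * Xᵀ * q.2) *ᵥ z)
    h.continuousAt ((continuousAt_inv_gram hX).prodMk continuousAt_id)

lemma continuousAt_halfWidth (hX : X.rank = p) (z : Fin N → ℝ) (α : ℝ) (j : Fin p) :
    ContinuousAt (fun W => halfWidth X W z α j) 1 := by
  have h1 := continuousAt_betaHat hX z
  have h2 := continuousAt_inv_gram hX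
  have h3 : ContinuousAt (fun W => sigmaHatSq X W z) 1 := by
    unfold sigmaHatSq
    have h : Continuous fun b : Fin p → ℝ => ∑ i, (z i - (X *ᵥ b) i) ^ 2 := by fun_prop
    exact continuousAt_const.mul (ContinuousAt.comp (f := fun W => betaHat X W z)
      h.continuousAt h1)
  have h4 : ContinuousAt (fun W => sandwich X W j j) 1 := by
    have h : Continuous fun q : Matrix (Fin p) (Fin p) ℝ × Matrix (Fin N) (Fin N) ℝ =>
        q.1 * (Xᵀ * q.2 ^ 2 * X) * q.1 := by fun_prop
    exact ContinuousAt.comp (f := fun W : Matrix (Fin N) (Fin N) ℝ => ((Xᵀ * W * X)⁻¹, W))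
      (g := fun q : Matrix (Fin p) (Fin p) ℝ × Matrix (Fin N) (Fin N) ℝ =>
        (show Matrix (Fin p) (Fin p) ℝ from q.1 * (Xᵀ * q.2 ^ 2 * X) * q.1) j j)
      (h.matrix_elem j j).continuousAt (h2.prodMk continuousAt_id)
  -- The square root is continuous on all of `ℝ`, so no positivity of the variance terms is needed.
  unfold halfWidth
  fun_prop

lemma measurableSet_covers (X : Matrix (Fin N) (Fin p) ℝ) (W : Matrix (Fin N) (Fin N) ℝ)
    (β : Fin p → ℝ) (σ α : ℝ) (j : Fin p) :
    MeasurableSet {z : Fin N → ℝ |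
      IsUnit (Xᵀ * W * X) ∧ β j ∈ confInterval X W (X *ᵥ β + σ • z) α j} := by
  have h1 : Measurable fun z => betaHat X W (X *ᵥ β + σ • z) := by
    have : Continuous fun z => betaHat X W (X *ᵥ β + σ • z) := by
      unfold betaHat
      fun_prop
    exact this.measurable
  have h2 : Measurable fun z => sigmaHatSq X W (X *ᵥ β + σ • z) := by
    have : Continuous fun z => sigmaHatSq X W (X *ᵥ β + σ • z) := by
      unfold sigmaHatSq betaHat
      fun_prop
    exact this.measurable
  have h3 : Measurable fun z => halfWidth X W (X *ᵥ β + σ • z) α j := by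
    unfold halfWidth
    fun_prop
  have h4 : Measurable fun z => betaHat X W (X *ᵥ β + σ • z) j := (measurable_pi_apply j).comp h1
  simp only [confInterval, Set.mem_Icc]
  refine (MeasurableSet.const _).inter (MeasurableSet.inter ?_ ?_)
  · exact measurableSet_le (h4.sub h3) measurable_const
  · exact measurableSet_le measurable_const (h4.add h3)

/-- The coverage probability, as a function of the weight matrix, tends to the nominal level at
the identity. -/
lemma tendsto_measureReal_covers (hX : X.rank = p) (hpN : p < N) (β : Fin p → ℝ) {σ : ℝ}
    (hσ : 0 < σ) (j : Fin p) {α : ℝ} (hα0 : 0 < α) (hα1 : α < 1) :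
    Tendsto (fun W : Matrix (Fin N) (Fin N) ℝ =>
      (Measure.pi fun _ : Fin N => gaussianReal 0 1).real
        {z | IsUnit (Xᵀ * W * X) ∧ β j ∈ confInterval X W (X *ᵥ β + σ • z) α j})
      (𝓝 1) (𝓝 (1 - α)) := by
  have hone := (eventually_isUnit hX).self_of_nhds
  have hcov : (Measure.pi fun _ : Fin N => gaussianReal 0 1).real
      {z | IsUnit (Xᵀ * (1 : Matrix (Fin N) (Fin N) ℝ) * X) ∧ β j ∈ confInterval X 1 (X *ᵥ β + σ • z) α j} = 1 - α := by
    rw [← measureReal_abs_betaHat_one_le hX hpN j hα0 hα1]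
    simp only [hone, true_and, mem_confInterval_affine_iff X hone β hσ]
  rw [← hcov]
  -- Dominated convergence requires a countably generated filter.
  have : FirstCountableTopology (Matrix (Fin N) (Fin N) ℝ) :=
    inferInstanceAs (FirstCountableTopology (Fin N → Fin N → ℝ))
  refine (ENNReal.tendsto_toReal (measure_ne_top _ _)).comp
    (tendsto_measure_of_ae_tendsto_indicator_of_isFiniteMeasure _
      (measurableSet_covers X 1 β σ α j) (fun W => measurableSet_covers X W β σ α j) ?_)
  filter_upwards [ae_abs_betaHat_one_ne hX hpN j α] with z hz
  have hb : ContinuousAt (fun W => |betaHat X W z j|) 1 :=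
    ContinuousAt.comp (f := fun W => betaHat X W z) (g := fun b => |b j|)
      (continuous_apply j).abs.continuousAt (continuousAt_betaHat hX z)
  have hh := continuousAt_halfWidth hX z α j
  rcases lt_or_gt_of_ne hz with hlt | hlt
  · filter_upwards [eventually_isUnit hX, hb.eventually_lt hh hlt] with W hW h
    simp only [hW, hone, mem_confInterval_affine_iff X _ β hσ, h.le, hlt.le]
  · filter_upwards [eventually_isUnit hX, hh.eventually_lt hb hlt] with W hW h
    simp only [hW, hone, mem_confInterval_affine_iff X _ β hσ, not_le.2 h, not_le.2 hlt]

end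

/-! ### Concentration of the weight matrix -/

/-- Each draw selects one observation, so it contributes to one diagonal entry only. In this form
the entries are sample means of `(π i)⁻¹` times an indicator. -/
lemma weightMatrix_eq_diagonal {N r : ℕ} {π : Fin N → ℝ} (hπ : ∀ i, 0 < π i)
    (s : Fin r → Fin N) :
    weightMatrix π s = Matrix.diagonal fun i =>
      (∑ k, if s k = i then (π i)⁻¹ else 0) / r := by
  ext i l
  have hterm : ∀ k, (1 / √((r : ℝ) * π (s k))) ^ 2 = (π (s k))⁻¹ / r := by
    intro k
    rw [div_pow, Real.sq_sqrt (mul_nonneg (Nat.cast_nonneg r) (hπ _).le)]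
    field_simp
  simp only [weightMatrix, scalingMatrix, samplingMatrix, Matrix.diagonal_pow, Matrix.mul_apply,
    Matrix.transpose_apply, Matrix.of_apply, Pi.pow_apply, hterm,
    Matrix.diagonal_apply, Finset.sum_div]
  split_ifs with hil
  · subst hil
    refine Finset.sum_congr rfl fun k _ => ?_
    split_ifs with h <;> simp [h]
  · refine Finset.sum_eq_zero fun k _ => ?_
    by_cases h : s k = i
    · simp [h, hil]
    · simp [h]

/-- Chebyshev's inequality for the mean of independent bounded variables. -/
lemma measureReal_le_abs_mean_sub {Ω : Type*} [MeasurableSpace Ω] {P : Measure Ω}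
    [IsProbabilityMeasure P] {r : ℕ} (hr : 0 < r) {ξ : Fin r → Ω → ℝ}
    (hm : ∀ k, Measurable (ξ k)) {C : ℝ} (hC : ∀ k ω, ξ k ω ∈ Set.Icc 0 C)
    (hind : iIndepFun ξ P) {m : ℝ} (hmean : ∀ k, P[ξ k] = m) {δ : ℝ} (hδ : 0 < δ) :
    P.real {ω | δ ≤ |(∑ k, ξ k ω) / r - m|} ≤ (C / 2) ^ 2 / δ ^ 2 / r := by
  have hr' : (0 : ℝ) < r := Nat.cast_pos.2 hr
  have hLp : ∀ k, MemLp (ξ k) 2 P := fun k =>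
    memLp_of_bounded (ae_of_all _ (hC k)) (hm k).aestronglyMeasurable 2
  have hvar : Var[∑ k, ξ k; P] ≤ r * (C / 2) ^ 2 := by
    rw [IndepFun.variance_sum (fun k _ => hLp k) fun k _ l _ hkl => hind.indepFun hkl]
    calc ∑ k, Var[ξ k; P] ≤ ∑ _k : Fin r, (C / 2) ^ 2 := Finset.sum_le_sum fun k _ => by
          -- Popoviciu: the variance is at most the square of half the range.
          simpa using variance_le_sq_of_bounded (ae_of_all P (hC k)) (hm k).aemeasurable
      _ = r * (C / 2) ^ 2 := by simp
  have hmean' : P[∑ k, ξ k] = r * m := by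
    simp only [Finset.sum_apply]
    rw [integral_finsetSum _ fun k _ => (hLp k).integrable one_le_two]
    simp [hmean]
  have hcheb := meas_ge_le_variance_div_sq (memLp_finsetSum' Finset.univ fun k _ => hLp k)
    (mul_pos hr' hδ)
  rw [hmean'] at hcheb
  have hset : {ω | δ ≤ |(∑ k, ξ k ω) / r - m|} =
      {ω | r * δ ≤ |(∑ k, ξ k) ω - r * m|} := by
    ext ω
    have : (∑ k, ξ k) ω - r * m = r * ((∑ k, ξ k ω) / r - m) := by
      rw [Finset.sum_apply]
      field_simp
    rw [Set.mem_ofPred_eq, Set.mem_ofPred_eq, this, abs_mul, abs_of_pos hr',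
      mul_le_mul_iff_right₀ hr']
  rw [hset]
  calc P.real _ ≤ Var[∑ k, ξ k; P] / (r * δ) ^ 2 :=
        ENNReal.toReal_le_of_le_ofReal (div_nonneg (variance_nonneg _ _) (sq_nonneg _)) hcheb
    _ ≤ r * (C / 2) ^ 2 / (r * δ) ^ 2 := by gcongr
    _ = (C / 2) ^ 2 / δ ^ 2 / r := by field_simp

/-- The random weight matrix converges in probability to the identity. -/
lemma tendsto_measureReal_weightMatrix_notMem {N : ℕ} {π : Fin N → ℝ} (hπ : ∀ i, 0 < π i)
    {Ω : Type*} [MeasurableSpace Ω] {P : Measure Ω} [IsProbabilityMeasure P]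
    {s : (r : ℕ) → Fin r → Ω → Fin N} (hs_meas : ∀ r k, Measurable (s r k))
    (hs_law : ∀ r k i, P.real {ω | s r k ω = i} = π i) (hs_indep : ∀ r, iIndepFun (s r) P)
    {U : Set (Matrix (Fin N) (Fin N) ℝ)} (hU : U ∈ 𝓝 1) :
    Tendsto (fun r : ℕ => P.real {ω | weightMatrix π (fun k => s r k ω) ∉ U}) atTop (𝓝 0) := by
  have hdiag : Continuous fun w : Fin N → ℝ => Matrix.diagonal w := by fun_prop
  have hpre : (fun w : Fin N → ℝ => Matrix.diagonal w) ⁻¹' U ∈ 𝓝 1 :=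
    hdiag.continuousAt (by simpa [Pi.one_def, Matrix.diagonal_one] using hU)
  obtain ⟨δ, hδ, hball⟩ := Metric.mem_nhds_iff.1 hpre
  have hbound : ∀ᶠ r : ℕ in atTop, P.real {ω | weightMatrix π (fun k => s r k ω) ∉ U} ≤
      ∑ i, ((π i)⁻¹ / 2) ^ 2 / δ ^ 2 / r := by
    filter_upwards [eventually_gt_atTop 0] with r hr
    -- Leaving a sup-norm ball forces some diagonal entry to be at least `δ` away from 1; a union
    -- bound over the entries follows.
    have hsub : {ω | weightMatrix π (fun k => s r k ω) ∉ U} ⊆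
        ⋃ i, {ω | δ ≤ |(∑ k, if s r k ω = i then (π i)⁻¹ else 0) / r - 1|} := by
      intro ω hω
      by_contra hcon
      simp only [Set.mem_iUnion, Set.mem_ofPred_eq, not_exists, not_le] at hcon
      refine hω ?_
      rw [weightMatrix_eq_diagonal hπ]
      refine hball ?_
      rw [Metric.mem_ball, dist_pi_lt_iff hδ]
      exact fun i => by simpa [Real.dist_eq] using hcon i
    refine (measureReal_mono hsub).trans ((measureReal_iUnion_fintype_le _).trans
      (Finset.sum_le_sum fun i _ => ?_))
    have hg : Measurable fun l : Fin N => if l = i then (π i)⁻¹ else 0 := measurable_of_finite _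
    refine measureReal_le_abs_mean_sub hr (ξ := fun k ω => if s r k ω = i then (π i)⁻¹ else 0)
      (fun k => hg.comp (hs_meas r k)) (fun k ω => ?_)
      ((hs_indep r).comp (fun _ => _) fun _ => hg) (fun k => ?_) hδ
    · have := (inv_pos.2 (hπ i)).le
      split_ifs <;> simp [this]
    · have hset : MeasurableSet {ω | s r k ω = i} := hs_meas r k (measurableSet_singleton i)
      have heq : (fun ω => if s r k ω = i then (π i)⁻¹ else 0) =
          {ω | s r k ω = i}.indicator fun _ => (π i)⁻¹ := by
        ext ω
        simp [Set.indicator_apply]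
      rw [heq, integral_indicator_const _ hset, hs_law, smul_eq_mul, mul_inv_cancel₀ (hπ i).ne']
  refine squeeze_zero' (Eventually.of_forall fun r => measureReal_nonneg) hbound ?_
  have h := tendsto_finsetSum (Finset.univ : Finset (Fin N)) fun i _ =>
    tendsto_const_div_atTop_nhds_zero_nat (((π i)⁻¹ / 2) ^ 2 / δ ^ 2)
  rwa [Finset.sum_const_zero] at h

/-! ### Averaging over the random weights -/

/-- If `w r` converges in probability to `e` and the bounded function `f` tends to `L` at `e`,
then the expectation of `f (w r)` tends to `L`. -/
lemma tendsto_integral_comp_of_tendsto_measureReal {Ω E : Type*} [MeasurableSpace Ω]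
    [TopologicalSpace E] {P : Measure Ω} [IsProbabilityMeasure P] {w : ℕ → Ω → E} {e : E}
    (hw : ∀ U ∈ 𝓝 e, Tendsto (fun r => P.real {ω | w r ω ∉ U}) atTop (𝓝 0))
    {f : E → ℝ} {L : ℝ} (hf : Tendsto f (𝓝 e) (𝓝 L))
    (hm : ∀ r, Measurable fun ω => f (w r ω)) {C : ℝ} (hC : ∀ x, |f x - L| ≤ C) :
    Tendsto (fun r => ∫ ω, f (w r ω) ∂P) atTop (𝓝 L) := by
  have hC0 : 0 ≤ C := (abs_nonneg _).trans (hC e)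
  have hfint : ∀ r, Integrable (fun ω => f (w r ω)) P := fun r =>
    Integrable.of_bound (hm r).aestronglyMeasurable (C + |L|) (ae_of_all _ fun ω => by
      have := abs_add_le (f (w r ω) - L) L
      rw [sub_add_cancel] at this
      exact this.trans (by linarith [hC (w r ω)]))
  have hint : ∀ r, Integrable (fun ω => f (w r ω) - L) P := fun r =>
    (hfint r).sub (integrable_const L)
  rw [Metric.tendsto_atTop']
  intro ε hε
  have hU : {x | |f x - L| < ε / 2} ∈ 𝓝 e :=
    Metric.tendsto_nhds.1 hf (ε / 2) (half_pos hε)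
  have hlim : Tendsto (fun r => ε / 2 + C * P.real {ω | w r ω ∉ {x | |f x - L| < ε / 2}})
      atTop (𝓝 (ε / 2)) := by
    simpa using ((hw _ hU).const_mul C).const_add (ε / 2)
  refine (eventually_atTop.1 (hlim.eventually_lt_const (half_lt_self hε))).imp fun r₀ h r hr => ?_
  refine lt_of_le_of_lt ?_ (h r hr.le)
  -- The integrand is at most `C` on the exceptional event `A` and less than `ε / 2` off it.
  set A := {ω | w r ω ∉ {x | |f x - L| < ε / 2}} with hA
  have hAm : MeasurableSet A :=
    (measurableSet_lt ((hm r).sub_const L).abs measurable_const).compl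
  have hsub : (∫ ω, f (w r ω) ∂P) - L = ∫ ω, (f (w r ω) - L) ∂P := by
    rw [integral_sub (hfint r) (integrable_const L)]
    simp
  rw [Real.dist_eq, hsub]
  have hindic : Integrable (A.indicator fun _ => C) P := (integrable_const C).indicator hAm
  calc |∫ ω, (f (w r ω) - L) ∂P| ≤ ∫ ω, |f (w r ω) - L| ∂P := abs_integral_le_integral_abs
    _ ≤ ∫ ω, (ε / 2 + A.indicator (fun _ => C) ω) ∂P := by
        refine integral_mono (hint r).abs ((integrable_const _).add hindic) fun ω => ?_
        by_cases hω : ω ∈ A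
        · rw [Set.indicator_of_mem hω]
          linarith [hC (w r ω)]
        · rw [Set.indicator_of_notMem hω, add_zero]
          exact (not_not.1 hω).le
    _ = ε / 2 + C * P.real A := by
        rw [integral_add (integrable_const _) hindic, integral_indicator_const _ hAm]
        simp [mul_comm]

/-- Conditioning an event on one of two independent variables. -/
lemma measureReal_mem_eq_integral {Ω S E : Type*} [MeasurableSpace Ω] [MeasurableSpace S]
    [MeasurableSpace E] [Countable S] [MeasurableSingletonClass S] {P : Measure Ω}
    [IsProbabilityMeasure P] {U : Ω → S} {Z : Ω → E} (hU : Measurable U) (hZ : AEMeasurable Z P)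
    (hind : IndepFun U Z P) {G : S → Set E} (hG : ∀ u, MeasurableSet (G u)) :
    P.real {ω | Z ω ∈ G (U ω)} = ∫ ω, (P.map Z).real (G (U ω)) ∂P := by
  -- Countability of `S` gives joint measurability slice by slice.
  have hprod : MeasurableSet {q : S × E | q.2 ∈ G q.1} := by
    have h : {q : S × E | q.2 ∈ G q.1} = ⋃ u, {u} ×ˢ G u := by
      ext ⟨u, e⟩
      simp
    rw [h]
    exact MeasurableSet.iUnion fun u => (measurableSet_singleton u).prod (hG u)
  have := Measure.isProbabilityMeasure_map hZ
  have := Measure.isProbabilityMeasure_map (μ := P) hU.aemeasurable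
  have h1 : P {ω | Z ω ∈ G (U ω)} = ∫⁻ ω, (P.map Z) (G (U ω)) ∂P := by
    have h2 := Measure.map_apply_of_aemeasurable (hU.aemeasurable.prodMk hZ) hprod
    rw [hind.map_prod_eq_prod_map_map hU.aemeasurable hZ, Measure.prod_apply hprod,
      lintegral_map (measurable_measure_prodMk_left hprod) hU] at h2
    exact h2.symm
  have hmeas : Measurable fun ω => (P.map Z) (G (U ω)) :=
    (measurable_of_countable fun u => (P.map Z) (G u)).comp hU
  rw [measureReal_def, h1]
  exact (integral_toReal hmeas.aemeasurable (ae_of_all _ fun ω => measure_lt_top _ _)).symm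

end AlgLev

theorem mainTheorem1 {N p : ℕ} (hpN : p < N)
    -- design matrix of full (column) rank, coefficients, error variance
    (X : Matrix (Fin N) (Fin p) ℝ) (hX : X.rank = p)
    (β : Fin p → ℝ) (σ : ℝ) (hσ : 0 < σ)
    -- sampling distribution on the observations, without zero entries
    (π : Fin N → ℝ) (hπ_pos : ∀ i, 0 < π i) (hπ_sum : ∑ i, π i = 1)
    {Ω : Type*} [MeasurableSpace Ω] (P : Measure Ω) [IsProbabilityMeasure P]
    -- i.i.d. normal errors and the responses
    (ε : Fin N → Ω → ℝ) (hε_law : ∀ i, HasLaw (ε i) (gaussianReal 0 (Real.toNNReal (σ ^ 2))) P)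
    (hε_indep : iIndepFun ε P)
    (Y : Ω → Fin N → ℝ) (hY : ∀ ω i, Y ω i = X i ⬝ᵥ β + ε i ω)
    -- for each sample size `r`, `r` i.i.d. draws from `π`, independent of the errors
    (s : (r : ℕ) → Fin r → Ω → Fin N) (hs_meas : ∀ r k, Measurable (s r k))
    (hs_law : ∀ r k i, P.real {ω | s r k ω = i} = π i)
    (hs_indep : ∀ r, iIndepFun (s r) P)
    (hsε : ∀ r, IndepFun (fun ω k => s r k ω) (fun ω i => ε i ω) P)
    (α : ℝ) (hα0 : 0 < α) (hα1 : α < 1) (j : Fin p) :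
    -- the interval is well defined with probability tending to one ...
    Tendsto (fun r : ℕ => P.real {ω |
      IsUnit (Xᵀ * AlgLev.weightMatrix π (fun k => s r k ω) * X)}) atTop (𝓝 1) ∧
    -- ... and it is well defined and covers `β j` with probability tending to `1 - α`
    Tendsto (fun r : ℕ => P.real {ω |
      IsUnit (Xᵀ * AlgLev.weightMatrix π (fun k => s r k ω) * X) ∧
      β j ∈ AlgLev.confInterval X (AlgLev.weightMatrix π (fun k => s r k ω)) (Y ω) α j})
      atTop (𝓝 (1 - α)) := by
  set W : (r : ℕ) → Ω → Matrix (Fin N) (Fin N) ℝ :=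
    fun r ω => AlgLev.weightMatrix π (fun k => s r k ω) with hW
  have hconv : ∀ U ∈ 𝓝 (1 : Matrix (Fin N) (Fin N) ℝ),
      Tendsto (fun r => P.real {ω | W r ω ∉ U}) atTop (𝓝 0) := fun U hU =>
    AlgLev.tendsto_measureReal_weightMatrix_notMem hπ_pos hs_meas hs_law hs_indep hU
  have hs : ∀ r, Measurable fun ω k => s r k ω := fun r => measurable_pi_lambda _ (hs_meas r)
  constructor
  · have h := (hconv _ (AlgLev.eventually_isUnit hX)).const_sub 1
    rw [sub_zero] at h
    refine h.congr fun r => ?_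
    have hset : MeasurableSet {ω | IsUnit (Xᵀ * W r ω * X)} :=
      hs r (MeasurableSet.of_discrete
        (s := {u : Fin r → Fin N | IsUnit (Xᵀ * AlgLev.weightMatrix π u * X)}))
    rw [sub_eq_iff_eq_add, add_comm, ← probReal_add_probReal_compl (μ := P) hset, add_comm]
    rfl
  -- Standardizing the errors reduces their law to the standard Gaussian product used for fixed
  -- weights.
  · set Z : Ω → Fin N → ℝ := fun ω i => σ⁻¹ * ε i ω with hZ
    have hZlaw : ∀ i, HasLaw (fun ω => σ⁻¹ * ε i ω) (gaussianReal 0 1) P := by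
      intro i
      have h := gaussianReal_const_mul (hε_law i) σ⁻¹
      convert h using 2
      · simp
      · ext
        simp only [NNReal.coe_one, NNReal.coe_mul, NNReal.coe_mk,
          Real.coe_toNNReal _ (sq_nonneg σ)]
        field_simp
    have hZm : AEMeasurable Z P := aemeasurable_pi_lambda _ fun i => (hZlaw i).aemeasurable
    have hZpi : P.map Z = Measure.pi fun _ => gaussianReal 0 1 := by
      have hind : iIndepFun (fun i ω => σ⁻¹ * ε i ω) P :=
        hε_indep.comp (fun _ x => σ⁻¹ * x) fun _ => measurable_const_mul _
      rw [hZ, (iIndepFun_iff_map_fun_eq_pi_map fun i => (hZlaw i).aemeasurable).1 hind]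
      simp_rw [(hZlaw _).map_eq]
    have hYZ : ∀ ω, Y ω = X *ᵥ β + σ • Z ω := by
      intro ω
      ext i
      simp only [hY, hZ, Pi.add_apply, Pi.smul_apply, smul_eq_mul, mul_inv_cancel_left₀ hσ.ne']
      rfl
    have hsZ : ∀ r, IndepFun (fun ω k => s r k ω) Z P := fun r =>
      (hsε r).comp measurable_id (ψ := fun (e : Fin N → ℝ) i => σ⁻¹ * e i) (by fun_prop)
    set f : Matrix (Fin N) (Fin N) ℝ → ℝ := fun V =>
      (Measure.pi fun _ : Fin N => gaussianReal 0 1).real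
        {z | IsUnit (Xᵀ * V * X) ∧ β j ∈ AlgLev.confInterval X V (X *ᵥ β + σ • z) α j} with hf
    have hcover : ∀ r, P.real {ω | IsUnit (Xᵀ * W r ω * X) ∧
        β j ∈ AlgLev.confInterval X (W r ω) (Y ω) α j} = ∫ ω, f (W r ω) ∂P := by
      intro r
      simp_rw [hYZ, hf, ← hZpi]
      exact AlgLev.measureReal_mem_eq_integral (hs r) hZm (hsZ r) fun u =>
        AlgLev.measurableSet_covers X (AlgLev.weightMatrix π u) β σ α j
    refine Tendsto.congr (fun r => (hcover r).symm) ?_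
    refine AlgLev.tendsto_integral_comp_of_tendsto_measureReal hconv
      (AlgLev.tendsto_measureReal_covers hX hpN β hσ j hα0 hα1)
      -- There are finitely many samples of size `r`, so measurability of `f` itself is not needed.
      (fun r => (measurable_of_countable fun u => f (AlgLev.weightMatrix π u)).comp (hs r))
      (C := 1) fun V => ?_
    have h0 : 0 ≤ f V := measureReal_nonneg
    have h1 : f V ≤ 1 := measureReal_le_one
    rw [abs_le]
    constructor <;> linarith
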